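/- Let $\mathbb{Y}$ be a (real) Banach space, let $A\subseteq \mathbb{Y}$ be a nonempty, bounded, convex, closed subset, and let $(X,\rho)$ be a complete metric space. Let $C : A \to X$ be a compact mapping, that is, $C$ is continuous and maps bounded subsets of $A$ to relatively compact subsets of $X$. Let $\mathcal{T} : A\times\overline{C(A)} \to A$ be a continuous mapping (for the product topology) which satisfies the Kannan type equicontraction condition: there is a constant $k\in[0,\tfrac12)$ such that for all $u_1,u_2\in A$ and all $v\in\overline{C(A)}$, $$\|\mathcal{T}(u_1,v)-\mathcal{T}(u_2,v)\|\le k\bigl(\|\mathcal{T}(u_1,v)-u_1\|+\|\mathcal{T}(u_2,v)-u_2\|\bigr).$$ Then the equation $\mathcal{T}(u,C(u))=u$ has a solution $u\in A$. -/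

import Mathlib

/-- A compact mapping `C : A → X` (in general nonlinear), defined on a subset `A` of a metric
space `Y`: it is continuous and sends bounded sets to relatively compact sets. -/
def IsCompactMapping {Y X : Type*} [MetricSpace Y] [MetricSpace X] {A : Set Y}
    (C : A → X) : Prop :=
  Continuous C ∧ ∀ B : Set A, Bornology.IsBounded B → IsCompact (closure (C '' B))

/-- The Kannan type equicontraction condition for a mapping `T : A × S → Y`, where `A ⊆ Y`; the
constant `k` is the same for all points. -/
def IsKannanEquicontraction {Y X : Type*} [NormedAddCommGroup Y] {A : Set Y} {S : Set X}
    (T : A × S → Y) : Prop :=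
  ∃ k : ℝ, 0 ≤ k ∧ k < 1 / 2 ∧ ∀ (u₁ u₂ : A) (v : S),
    ‖T (u₁, v) - T (u₂, v)‖ ≤ k * (‖T (u₁, v) - (u₁ : Y)‖ + ‖T (u₂, v) - (u₂ : Y)‖)

/-! Freeze the second variable. Each `T (·, v)` is a Kannan map, so it has a fixed point `φ v`, and
the Kannan inequality bounds `‖φ w - φ v‖` by `(1 + k) * ‖T (φ v, w) - φ v‖`, which makes `φ`
continuous. Since `A` is bounded and `C` compact, `φ` is defined on a compact set and has compact
range in `A`. Schauder's theorem gives `u = φ (C u)`, which solves the equation.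

Schauder is reduced to Brouwer on a simplex through finite ε-nets of the compact set. Brouwer comes
from Scarf's lemma, a parity argument in the manner of Sperner: dominant sets take the place of the
cells of a triangulation, and slack points that of its boundary. -/

/-! ### Scarf's combinatorial lemma -/

section Scarf

open Finset

variable {ι P T α : Type*} [LinearOrder α]

/-- A finite set `σ` is dominant for a family of rankings `r` if no point lies strictly above
the minimum of `σ` for every ranking. -/
def IsDominant (r : ι → P → α) (σ : Finset P) : Prop :=
  ∀ y, ∃ i, ∀ x ∈ σ, r i y ≤ r i x

theorem IsDominant.mono {r : ι → P → α} {σ τ : Finset P} (h : IsDominant r σ) (hτ : τ ⊆ σ) :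
    IsDominant r τ := fun y => (h y).imp fun _ hi x hx => hi x (hτ hx)

/-- A set with one element less than there are rankings is contained in an even number of
dominant sets with as many elements as rankings, if it can be exceeded in all rankings but one. -/
theorem even_card_dominant_superset [Fintype ι] [DecidableEq ι] [Fintype P] [DecidableEq P]
    {r : ι → P → α} (hr : ∀ i, Function.Injective (r i)) {Q : Finset P} (hQ : Q.Nonempty)
    (hcard : #Q + 1 = Fintype.card ι)
    (hex : ∀ l, ∃ z, ∀ k, k ≠ l → ∃ q ∈ Q, r k q < r k z) (R : Finset (Finset P))
    (hR : ∀ σ, σ ∈ R ↔ #σ = Fintype.card ι ∧ IsDominant r σ) :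
    Even #{σ ∈ R | Q ⊆ σ} := by
  rcases Finset.eq_empty_or_nonempty {σ ∈ R | Q ⊆ σ} with he | ⟨σ₀, hσ₀⟩
  · simp [he]
  have hdom : IsDominant r Q := by
    rw [mem_filter, hR] at hσ₀
    exact hσ₀.1.2.mono hσ₀.2
  have hmin : ∀ i, ∃ x ∈ Q, ∀ q ∈ Q, r i x ≤ r i q := fun i => exists_min_image Q (r i) hQ
  choose m hmQ hm using hmin
  have hsurj : ∀ q ∈ Q, ∃ i, m i = q := by
    intro q hq
    obtain ⟨i, hi⟩ := hdom q
    exact ⟨i, hr i (le_antisymm (hm i q hq) (hi _ (hmQ i)))⟩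
  -- The minima `m` map the rankings onto `Q`, which has one element less, so exactly one pair `i,
  -- j` collides. Dropping either index makes `m` bijective; this yields the two dominant supersets.
  obtain ⟨i, -, j, -, hij, hmij⟩ : ∃ i ∈ (univ : Finset ι), ∃ j ∈ (univ : Finset ι),
      i ≠ j ∧ m i = m j :=
    exists_ne_map_eq_of_card_lt_of_maps_to (t := Q) (by rw [card_univ]; omega)
      (fun i _ => hmQ i)
  have hinj : ∀ l, (∀ q ∈ Q, ∃ k, k ≠ l ∧ m k = q) →
      Set.InjOn m ((univ.erase l : Finset ι) : Set ι) := by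
    intro l hl
    rw [← card_image_iff]
    have : image m (univ.erase l) = Q := by
      ext q
      simp only [mem_image, mem_erase, mem_univ, and_true]
      exact ⟨by rintro ⟨k, -, rfl⟩; exact hmQ k, hl q⟩
    rw [this, card_erase_of_mem (mem_univ l), card_univ]
    omega
  -- The point to add: highest in ranking `l` among those above the minimum of `Q` in every other
  -- ranking.
  let Z : ι → P → Prop := fun l z => (∀ k, k ≠ l → r k (m k) < r k z) ∧
    ∀ y, (∀ k, k ≠ l → r k (m k) < r k y) → r l y ≤ r l z
  have hZex : ∀ l, ∃ z, Z l z := by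
    intro l
    obtain ⟨z, hz⟩ := hex l
    classical
    obtain ⟨w, hw, hw'⟩ := exists_max_image
      (univ.filter fun z => ∀ k, k ≠ l → r k (m k) < r k z) (r l)
      ⟨z, by
        simp only [mem_filter, mem_univ, true_and]
        intro k hk
        obtain ⟨q, hq, hqz⟩ := hz k hk
        exact (hm k q hq).trans_lt hqz⟩
    simp only [mem_filter, mem_univ, true_and] at hw hw'
    exact ⟨w, hw, hw'⟩
  have hZuniq : ∀ l z z', Z l z → Z l z' → z = z' := fun l z z' h h' =>
    hr l (le_antisymm (h'.2 z h.1) (h.2 z' h'.1))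
  have hZle : ∀ l z, Z l z → ∀ q ∈ Q, r l z ≤ r l q := by
    intro l z h
    obtain ⟨k, hk⟩ := hdom z
    by_cases hkl : k = l
    · rwa [hkl] at hk
    · exact absurd (hk _ (hmQ k)) (not_le.2 (h.1 k hkl))
  have hsurj' : ∀ l, l = i ∨ l = j → ∀ q ∈ Q, ∃ k, k ≠ l ∧ m k = q := by
    intro l hl q hq
    obtain ⟨k, rfl⟩ := hsurj q hq
    by_cases hkl : k = l
    · subst hkl
      rcases hl with rfl | rfl
      · exact ⟨j, hij.symm, hmij.symm⟩
      · exact ⟨i, hij, hmij⟩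
    · exact ⟨k, hkl, rfl⟩
  have hZnot : ∀ l, l = i ∨ l = j → ∀ z, Z l z → z ∉ Q := by
    intro l hl z hz hzQ
    obtain ⟨k, hk, rfl⟩ := hsurj' l hl z hzQ
    exact lt_irrefl _ (hz.1 k hk)
  have hZroom : ∀ l, l = i ∨ l = j → ∀ z, Z l z → insert z Q ∈ R := by
    intro l hl z hz
    rw [hR, card_insert_of_notMem (hZnot l hl z hz)]
    refine ⟨hcard, fun y => ?_⟩
    by_cases hy : ∀ k, k ≠ l → r k (m k) < r k y
    · refine ⟨l, fun x hx => ?_⟩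
      rcases mem_insert.1 hx with rfl | hx
      · exact hz.2 y hy
      · exact (hz.2 y hy).trans (hZle l z hz x hx)
    · push Not at hy
      obtain ⟨k, hk, hky⟩ := hy
      refine ⟨k, fun x hx => hky.trans ?_⟩
      rcases mem_insert.1 hx with rfl | hx
      · exact (hz.1 k hk).le
      · exact hm k x hx
  obtain ⟨zi, hzi⟩ := hZex i
  obtain ⟨zj, hzj⟩ := hZex j
  have hne : zi ≠ zj := by
    rintro rfl
    exact absurd (hZle i zi hzi _ (hmQ i)) (not_le.2 (hzj.1 i hij))
  have hset : {σ ∈ R | Q ⊆ σ} = {insert zi Q, insert zj Q} := by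
    ext σ
    simp only [mem_filter, mem_insert, mem_singleton]
    constructor
    · rintro ⟨hσ, hQσ⟩
      obtain ⟨hσc, hσd⟩ := (hR σ).1 hσ
      obtain ⟨z, hz, rfl⟩ := (covBy_iff_exists_insert (s := Q) (t := σ)).1
        (covBy_iff_card_sdiff_eq_one.2 ⟨hQσ, by rw [card_sdiff_of_subset hQσ]; omega⟩)
      obtain ⟨l, hl⟩ := hσd z
      have hlQ : ∀ q ∈ Q, ∃ k, k ≠ l ∧ m k = q ∧ r k q < r k z := by
        intro q hq
        obtain ⟨k, hk⟩ := hσd q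
        have hzq : z ≠ q := fun h => hz (h ▸ hq)
        have hlt : r k q < r k z :=
          lt_of_le_of_ne (hk z (mem_insert_self _ _)) fun h => hzq (hr k h).symm
        refine ⟨k, ?_, hr k (le_antisymm (hm k q hq) (hk _ (mem_insert_of_mem (hmQ k)))), hlt⟩
        rintro rfl
        exact absurd (hl q (mem_insert_of_mem hq)) (not_le.2 hlt)
      have hI := hinj l fun q hq => (hlQ q hq).imp fun k hk => ⟨hk.1, hk.2.1⟩
      have hlij : l = i ∨ l = j := by
        by_contra! h
        exact hij (hI (by simpa using h.1.symm) (by simpa using h.2.symm) hmij)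
      have hZz : Z l z := by
        have h1 : ∀ k, k ≠ l → r k (m k) < r k z := by
          intro k hk
          obtain ⟨k', hk', hmk, hlt⟩ := hlQ (m k) (hmQ k)
          rwa [hI (by simpa using hk') (by simpa using hk) hmk] at hlt
        refine ⟨h1, fun y hy => ?_⟩
        obtain ⟨k, hk⟩ := hσd y
        by_cases hkl : k = l
        · subst hkl
          exact hk z (mem_insert_self _ _)
        · exact absurd (hk _ (mem_insert_of_mem (hmQ k))) (not_le.2 (hy k hkl))
      rcases hlij with rfl | rfl
      · exact Or.inl (by rw [hZuniq _ _ _ hZz hzi])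
      · exact Or.inr (by rw [hZuniq _ _ _ hZz hzj])
    · rintro (rfl | rfl)
      · exact ⟨hZroom i (Or.inl rfl) _ hzi, subset_insert _ _⟩
      · exact ⟨hZroom j (Or.inr rfl) _ hzj, subset_insert _ _⟩
  rw [hset, card_pair]
  · exact even_two
  · intro h
    have : zi ∈ insert zj Q := h ▸ mem_insert_self _ _
    rcases mem_insert.1 this with h | h
    · exact hne h
    · exact hZnot i (Or.inl rfl) _ hzi h

/-- A set that does not carry all colours contains an even number of subsets of one element
less that carry all colours but `a`. -/
theorem even_card_facets [Fintype ι] [DecidableEq ι] [DecidableEq P] (c : P → ι) (a : ι)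
    {σ : Finset P} (hσ : #σ = Fintype.card ι) (hc : image c σ ≠ univ) (D : Finset (Finset P))
    (hD : ∀ Q, Q ∈ D ↔ #Q + 1 = Fintype.card ι ∧ image c Q = univ.erase a) :
    Even #{Q ∈ D | Q ⊆ σ} := by
  rcases Finset.eq_empty_or_nonempty {Q ∈ D | Q ⊆ σ} with he | ⟨Q, hQ⟩
  · simp [he]
  obtain ⟨hQD, hQσ⟩ := mem_filter.1 hQ
  obtain ⟨hQc, hQi⟩ := (hD Q).1 hQD
  obtain ⟨x, hx, rfl⟩ := (covBy_iff_exists_insert (s := Q) (t := σ)).1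
    (covBy_iff_card_sdiff_eq_one.2 ⟨hQσ, by rw [card_sdiff_of_subset hQσ]; omega⟩)
  have hinj : Set.InjOn c (Q : Set P) := by
    rw [← card_image_iff, hQi, card_erase_of_mem (mem_univ a), card_univ]
    omega
  have hxa : c x ≠ a := by
    intro h
    apply hc
    rw [image_insert, hQi, h, insert_erase (mem_univ a)]
  obtain ⟨y, hy, hyx⟩ : ∃ y ∈ Q, c y = c x := by
    rw [← mem_image, hQi]
    simpa using hxa
  have hxy : x ≠ y := fun h => hx (h ▸ hy)
  -- The colour of `x` is repeated only by `y`, so only `x` or `y` can be dropped without losing a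
  -- colour.
  have hset : {Q' ∈ D | Q' ⊆ insert x Q} = {Q, insert x (Q.erase y)} := by
    ext Q'
    simp only [mem_filter, mem_insert, mem_singleton]
    constructor
    · rintro ⟨h1, h2⟩
      obtain ⟨h3, h4⟩ := (hD Q').1 h1
      obtain ⟨z, hz, hzQ⟩ := (covBy_iff_exists_insert (s := Q') (t := insert x Q)).1
        (covBy_iff_card_sdiff_eq_one.2 ⟨h2, by rw [card_sdiff_of_subset h2]; omega⟩)
      have hQ' : Q' = (insert x Q).erase z := by rw [← hzQ, erase_insert hz]
      have hzm : z ∈ insert x Q := hzQ ▸ mem_insert_self _ _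
      by_cases hzx : z = x
      · left
        rw [hQ', hzx, erase_insert hx]
      · right
        have hzQ' : z ∈ Q := (mem_insert.1 hzm).resolve_left hzx
        have : c z ∈ image c Q' := by
          rw [h4, ← hQi]
          exact mem_image_of_mem c hzQ'
        obtain ⟨w, hw, hwz⟩ := mem_image.1 this
        have hwz' : w ≠ z := fun h => hz (h ▸ hw)
        have hwx : w = x := by
          by_contra h
          exact hwz' (hinj ((mem_insert.1 (h2 hw)).resolve_left h) hzQ' hwz)
        have hzy : z = y := hinj hzQ' hy (by rw [hyx, ← hwz, hwx])
        rw [hQ', hzy, erase_insert_of_ne hxy]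
    · rintro (rfl | rfl)
      · exact ⟨hQD, hQσ⟩
      · refine ⟨(hD _).2 ⟨?_, ?_⟩, insert_subset_insert _ (erase_subset _ _)⟩
        · rw [card_insert_of_notMem (fun h => hx (mem_of_mem_erase h)), card_erase_add_one hy,
            hQc]
        · rw [image_insert, ← hyx, ← image_insert, insert_erase hy, hQi]
  rw [hset, card_pair]
  · exact even_two
  · intro h
    exact hx (h ▸ mem_insert_self _ _)

/-- The set of all slack points but one is contained in exactly one dominant set with as many
elements as rankings. -/
theorem card_slack_superset [Fintype ι] [DecidableEq ι] [Finite T] [Nonempty T]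
    [DecidableEq (T ⊕ ι)] {r : ι → T ⊕ ι → α} (hr : ∀ i, Function.Injective (r i))
    (hlow : ∀ i y, r i (.inr i) ≤ r i y)
    (hhigh : ∀ i k t, k ≠ i → r i (.inl t) < r i (.inr k)) (a : ι) (R : Finset (Finset (T ⊕ ι)))
    (hR : ∀ σ, σ ∈ R ↔ #σ = Fintype.card ι ∧ IsDominant r σ) :
    #{σ ∈ R | (univ.erase a).map Function.Embedding.inr ⊆ σ} = 1 := by
  set B : Finset (T ⊕ ι) := (univ.erase a).map Function.Embedding.inr
  have hBmem : ∀ k, k ≠ a → (Sum.inr k : T ⊕ ι) ∈ B := fun k hk => by simp [B, hk]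
  have hBcard : #B + 1 = Fintype.card ι := by
    rw [card_map, card_erase_add_one (mem_univ a), card_univ]
  -- Slack point `k` is lowest in ranking `k`, so only ranking `a` can witness dominance over `t`;
  -- this forces the added point to be the top one.
  obtain ⟨t, ht⟩ : ∃ t : T, ∀ y : T, r a (.inl y) ≤ r a (.inl t) :=
    Finite.exists_max fun y : T => r a (.inl y)
  have htB : (Sum.inl t : T ⊕ ι) ∉ B := by simp [B]
  rw [card_eq_one]
  refine ⟨insert (.inl t) B, ?_⟩
  ext σ
  simp only [mem_filter, mem_singleton]
  constructor
  · rintro ⟨hσ, hBσ⟩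
    obtain ⟨hσc, hσd⟩ := (hR σ).1 hσ
    obtain ⟨z, hz, rfl⟩ := (covBy_iff_exists_insert (s := B) (t := σ)).1
      (covBy_iff_card_sdiff_eq_one.2 ⟨hBσ, by rw [card_sdiff_of_subset hBσ]; omega⟩)
    obtain ⟨k, hk⟩ := hσd (.inl t)
    have hka : k = a := by
      by_contra hka
      have h2 := hr k (le_antisymm (hk _ (mem_insert_of_mem (hBmem k hka))) (hlow k (.inl t)))
      cases h2
    subst hka
    have hzt := hk z (mem_insert_self _ _)
    rcases z with z | z
    · have := hr k (le_antisymm hzt (ht z))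
      rw [this]
    · by_cases hzk : z = k
      · subst hzk
        have h2 := hr z (le_antisymm hzt (hlow z (.inl t)))
        cases h2
      · exact absurd (hBmem z hzk) hz
  · rintro rfl
    refine ⟨(hR _).2 ⟨by rw [card_insert_of_notMem htB, hBcard], ?_⟩, subset_insert _ _⟩
    have key : ∀ y, r a y ≤ r a (.inl t) → ∀ x ∈ insert (Sum.inl t) B, r a y ≤ r a x := by
      intro y hy x hx
      rcases mem_insert.1 hx with rfl | hx
      · exact hy
      · obtain ⟨k, hk, rfl⟩ := mem_map.1 hx
        exact hy.trans (hhigh a k t (ne_of_mem_erase hk)).le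
    rintro (y | k)
    · exact ⟨a, key _ (ht y)⟩
    · exact ⟨k, fun x _ => hlow k x⟩

/-- **Scarf's lemma**: for rankings of a finite set `T` that has been enlarged by one slack
point for each ranking, some dominant set carries all colours. -/
theorem exists_dominant_colourful [Fintype ι] [Nonempty ι] [Finite T] [Nonempty T]
    {r : ι → T ⊕ ι → α} (hr : ∀ i, Function.Injective (r i))
    (hlow : ∀ i y, r i (.inr i) ≤ r i y)
    (hhigh : ∀ i k t, k ≠ i → r i (.inl t) < r i (.inr k)) (c : T → ι) :
    ∃ σ : Finset (T ⊕ ι), IsDominant r σ ∧ ∀ i, ∃ x ∈ σ, Sum.elim c id x = i := by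
  classical
  have := Fintype.ofFinite T
  obtain ⟨c', hc'⟩ : ∃ c' : T ⊕ ι → ι, c' = Sum.elim c id := ⟨_, rfl⟩
  rw [← hc']
  obtain ⟨R, hR⟩ : ∃ R : Finset (Finset (T ⊕ ι)),
      ∀ σ, σ ∈ R ↔ #σ = Fintype.card ι ∧ IsDominant r σ :=
    ⟨univ.filter fun σ => #σ = Fintype.card ι ∧ IsDominant r σ, fun σ => by simp⟩
  obtain ⟨a⟩ := ‹Nonempty ι›
  obtain ⟨D, hD⟩ : ∃ D : Finset (Finset (T ⊕ ι)),
      ∀ Q, Q ∈ D ↔ #Q + 1 = Fintype.card ι ∧ image c' Q = univ.erase a :=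
    ⟨univ.filter fun Q => #Q + 1 = Fintype.card ι ∧ image c' Q = univ.erase a,
      fun Q => by simp⟩
  -- Count pairs `Q ⊆ σ` twice. Without a colourful `σ` each `σ` contributes evenly, whereas each
  -- `Q` does so except `B`, which contributes one.
  by_contra! hno
  have hleft : Even (∑ σ ∈ R, #{Q ∈ D | Q ⊆ σ}) := by
    refine Finset.even_sum _ fun σ hσ => ?_
    refine even_card_facets c' a ((hR σ).1 hσ).1 (fun h => ?_) D hD
    obtain ⟨i, hi⟩ := hno σ ((hR σ).1 hσ).2
    obtain ⟨x, hx, hxi⟩ := mem_image.1 (h ▸ mem_univ i : i ∈ image c' σ)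
    exact hi x hx hxi
  obtain ⟨B, hBdef⟩ : ∃ B : Finset (T ⊕ ι), B = (univ.erase a).map Function.Embedding.inr :=
    ⟨_, rfl⟩
  have hBmem : ∀ k, k ≠ a → (Sum.inr k : T ⊕ ι) ∈ B := fun k hk => by simp [hBdef, hk]
  have hBcard : #B + 1 = Fintype.card ι := by
    rw [hBdef, card_map, card_erase_add_one (mem_univ a), card_univ]
  have hB : B ∈ D := by
    refine (hD B).2 ⟨hBcard, ?_⟩
    ext i
    simp [hBdef, hc']
  have hBone : #{σ ∈ R | B ⊆ σ} = 1  := by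
    rw [hBdef]
    exact card_slack_superset hr hlow hhigh a R hR
  have hright : Odd (∑ Q ∈ D, #{σ ∈ R | Q ⊆ σ}) := by
    rw [← add_sum_erase D _ hB, hBone, add_comm]
    refine Even.add_one (Finset.even_sum _ fun Q hQ => ?_)
    obtain ⟨hQB, hQD⟩ := mem_erase.1 hQ
    obtain ⟨hQc, hQi⟩ := (hD Q).1 hQD
    have hex : ∃ t : T, Sum.inl t ∈ Q := by
      by_contra! h
      refine hQB (eq_of_subset_of_card_le (fun x hx => ?_) (by omega))
      rcases x with x | x
      · exact absurd hx (h x)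
      · have : c' (.inr x) ∈ image c' Q := mem_image_of_mem c' hx
        rw [hQi, hc'] at this
        exact hBmem x (ne_of_mem_erase this)
    obtain ⟨s, hs⟩ := hex
    exact even_card_dominant_superset hr ⟨_, hs⟩ hQc
      (fun l => ⟨.inr l, fun k hk => ⟨_, hs, hhigh k l s hk.symm⟩⟩) R hR
  have hdouble : ∑ σ ∈ R, #{Q ∈ D | Q ⊆ σ} = ∑ Q ∈ D, #{σ ∈ R | Q ⊆ σ} := by
    simp only [card_filter]
    exact sum_comm
  rw [hdouble] at hleft
  exact (Nat.not_even_iff_odd.2 hright) hleft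

end Scarf

/-! ### Brouwer's fixed point theorem on the standard simplex -/

section Brouwer

open Finset

variable {ι : Type*} [Fintype ι]

/-- For every colouring of the grid points of a dilated simplex, some grid point has, for every
coordinate that is not small, a point of the corresponding colour nearby. -/
theorem exists_grid_point_near_colours [DecidableEq ι] [Nonempty ι] (N : ℕ)
    (c : piAntidiag (univ : Finset ι) N → ι) :
    ∃ x₀ : piAntidiag (univ : Finset ι) N, ∀ i, x₀.1 i ≤ Fintype.card ι ∨
      ∃ x, c x = i ∧ ∀ j, x.1 j ≤ x₀.1 j + Fintype.card ι ∧ x₀.1 j ≤ x.1 j + Fintype.card ι := by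
  have hsum : ∀ x : piAntidiag (univ : Finset ι) N, ∑ i, x.1 i = N := fun x =>
    (mem_piAntidiag.1 x.2).1
  have hmk : ∀ y : ι → ℕ, ∑ i, y i = N → y ∈ piAntidiag (univ : Finset ι) N := fun y hy =>
    mem_piAntidiag.2 ⟨hy, fun i _ => mem_univ i⟩
  have hle : ∀ (x : piAntidiag (univ : Finset ι) N) i, x.1 i ≤ N := fun x i =>
    (single_le_sum (f := x.1) (fun _ _ => Nat.zero_le _) (mem_univ i)).trans (hsum x).le
  have hne : Nonempty (piAntidiag (univ : Finset ι) N) :=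
    ⟨⟨Pi.single (Classical.arbitrary ι) N, hmk _ (by simp)⟩⟩
  let e := Fintype.equivFin (piAntidiag (univ : Finset ι) N ⊕ ι)
  -- Grid coordinates lie in `[0, N]`, so `-1` and `N + 1` put the slack points strictly outside;
  -- `e` breaks ties.
  let v : ι → piAntidiag (univ : Finset ι) N ⊕ ι → ℤ := fun i =>
    Sum.elim (fun t => (t.1 i : ℤ)) (fun k => if k = i then -1 else (N : ℤ) + 1)
  let r : ι → piAntidiag (univ : Finset ι) N ⊕ ι → ℤ ×ₗ Fin _ := fun i p => toLex (v i p, e p)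
  have hlt : ∀ i p q, v i p < v i q → r i p < r i q := fun i p q h =>
    Prod.Lex.toLex_lt_toLex.2 (Or.inl h)
  have hler : ∀ i p q, r i p ≤ r i q → v i p ≤ v i q := fun i p q h => by
    by_contra! h'
    exact absurd h (not_le.2 (hlt i q p h'))
  obtain ⟨σ, hσ, hcol⟩ := exists_dominant_colourful (r := r)
    (fun i p q h => e.injective (congrArg (fun z => (ofLex z).2) h))
    (by
      rintro i (t | k)
      · refine (hlt _ _ _ ?_).le
        simp only [v, Sum.elim_inl, Sum.elim_inr, if_true]
        omega
      · by_cases hk : k = i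
        · rw [hk]
        · refine (hlt _ _ _ ?_).le
          simp only [v, Sum.elim_inr, if_true, if_neg hk]
          omega)
    (by
      intro i k t hk
      apply hlt
      simp only [v, Sum.elim_inl, Sum.elim_inr, if_neg hk]
      have := hle t i
      omega) c
  have hdom : ∀ t : piAntidiag (univ : Finset ι) N, ∃ i, Sum.inr i ∉ σ ∧
      ∀ x, Sum.inl x ∈ σ → t.1 i ≤ x.1 i := by
    intro t
    obtain ⟨i, hi⟩ := hσ (.inl t)
    refine ⟨i, fun h => ?_, fun x hx => ?_⟩
    · have := hler _ _ _ (hi _ h)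
      simp only [v, Sum.elim_inl, Sum.elim_inr, if_true] at this
      omega
    · have := hler _ _ _ (hi _ hx)
      simpa [v] using this
  have hcolour : ∀ i, Sum.inr i ∉ σ → ∃ x, Sum.inl x ∈ σ ∧ c x = i := by
    intro i hi
    obtain ⟨x | k, hx, hxi⟩ := hcol i
    · exact ⟨x, hx, hxi⟩
    · simp only [Sum.elim_inr, id] at hxi
      exact absurd (hxi ▸ hx) hi
  obtain ⟨i₁, hi₁, -⟩ := hdom (Classical.arbitrary _)
  obtain ⟨x₀, hx₀, -⟩ := hcolour i₁ hi₁
  have hmin : ∀ i, ∃ a : ℕ, (∃ x, Sum.inl x ∈ σ ∧ x.1 i = a) ∧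
      ∀ x, Sum.inl x ∈ σ → a ≤ x.1 i := by
    intro i
    obtain ⟨x, hx, hxm⟩ := exists_min_image (univ.filter fun x => Sum.inl x ∈ σ)
      (fun x : piAntidiag (univ : Finset ι) N => x.1 i) ⟨x₀, by simpa using hx₀⟩
    exact ⟨x.1 i, ⟨x, by simpa using hx, rfl⟩, fun y hy => hxm y (by simpa using hy)⟩
  choose m hmx hm using hmin
  let m' : ι → ℕ := fun i => if Sum.inr i ∈ σ then 0 else m i
  have hm' : ∀ x, Sum.inl x ∈ σ → ∀ i, m' i ≤ x.1 i := by
    intro x hx i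
    by_cases hi : Sum.inr i ∈ σ
    · simp [m', hi]
    · simpa [m', hi] using hm i x hx
  -- Otherwise `m' + 1`, with the surplus put on `i₁`, is a grid point that exceeds the minima of
  -- `σ` and contradicts dominance.
  have hbig : N < ∑ i, m' i + Fintype.card ι := by
    by_contra! hN
    have hsm : ∑ i, (m' i + 1) ≤ N := by
      rw [sum_add_distrib]
      simpa using hN
    obtain ⟨i, hiσ, hi⟩ := hdom ⟨(fun i => m' i + 1) + Pi.single i₁ (N - ∑ i, (m' i + 1)),
      hmk _ (by
        simp only [Pi.add_apply]
        rw [sum_add_distrib (f := fun i => m' i + 1), Fintype.sum_pi_single']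
        omega)⟩
    obtain ⟨x, hx, hxm⟩ := hmx i
    have := hi x hx
    simp only [Pi.add_apply, m', if_neg hiσ] at this
    omega
  have hclose : ∀ x, Sum.inl x ∈ σ → ∀ j, x.1 j ≤ m' j + Fintype.card ι := by
    intro x hx j
    have h1 : x.1 j - m' j ≤ ∑ i, (x.1 i - m' i) :=
      single_le_sum (f := fun i => x.1 i - m' i) (fun _ _ => Nat.zero_le _) (mem_univ j)
    have h2 : ∑ i, (x.1 i - m' i) + ∑ i, m' i = N := by
      rw [← sum_add_distrib]
      exact (sum_congr rfl fun i _ => Nat.sub_add_cancel (hm' x hx i)).trans (hsum x)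
    omega
  refine ⟨x₀, fun i => ?_⟩
  by_cases hi : Sum.inr i ∈ σ
  · left
    simpa [m', hi] using hclose x₀ hx₀ i
  · right
    obtain ⟨x, hx, hxi⟩ := hcolour i hi
    exact ⟨x, hxi, fun j =>
      ⟨(hclose x hx j).trans (Nat.add_le_add_right (hm' x₀ hx₀ j) _),
        (hclose x₀ hx₀ j).trans (Nat.add_le_add_right (hm' x hx j) _)⟩⟩

/-- Colour a grid point by a coordinate that `f` does not decrease; one exists because both
coordinate sums are 1. Uniform continuity carries these inequalities from the nearby coloured points
to a single point. -/
theorem exists_forall_le_add_of_continuous_stdSimplex [Nonempty ι]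
    {f : stdSimplex ℝ ι → stdSimplex ℝ ι} (hf : Continuous f) {ε : ℝ} (hε : 0 < ε) :
    ∃ x, ∀ i, x.1 i ≤ (f x).1 i + ε := by
  classical
  have : CompactSpace (stdSimplex ℝ ι) := isCompact_iff_compactSpace.1 (isCompact_stdSimplex ℝ ι)
  obtain ⟨δ, hδ, hfδ⟩ := Metric.uniformContinuous_iff.1
    (CompactSpace.uniformContinuous_of_continuous hf) (ε / 2) (half_pos hε)
  set n : ℝ := (Fintype.card ι : ℝ) with hn
  obtain ⟨N, hN⟩ := exists_nat_gt (n / min δ (ε / 2))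
  have hmin : 0 < min δ (ε / 2) := lt_min hδ (half_pos hε)
  have hN0 : (0 : ℝ) < N := lt_of_le_of_lt (by positivity) hN
  have hnN : n / N < min δ (ε / 2) := by
    rw [div_lt_iff₀ hmin] at hN
    rwa [div_lt_iff₀ hN0, mul_comm]
  have hnδ := hnN.trans_le (min_le_left _ _)
  have hnε := hnN.trans_le (min_le_right _ _)
  let p : piAntidiag (univ : Finset ι) N → stdSimplex ℝ ι := fun t =>
    ⟨fun i => (t.1 i : ℝ) / N, fun i => by positivity, by
      rw [← sum_div, ← Nat.cast_sum, (mem_piAntidiag.1 t.2).1, div_self hN0.ne']⟩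
  have hcol : ∀ t, ∃ i, (p t).1 i ≤ (f (p t)).1 i := by
    intro t
    obtain ⟨i, -, hi⟩ := exists_le_of_sum_le (s := univ) univ_nonempty
      ((p t).2.2.trans (f (p t)).2.2.symm).le
    exact ⟨i, hi⟩
  choose c hc using hcol
  obtain ⟨x₀, hx₀⟩ := exists_grid_point_near_colours N c
  refine ⟨p x₀, fun i => ?_⟩
  rcases hx₀ i with h | ⟨x, rfl, hx⟩
  · have h1 : (p x₀).1 i ≤ n / N := by
      change (x₀.1 i : ℝ) / N ≤ n / N
      gcongr
      rw [hn]
      exact_mod_cast h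
    linarith [(f (p x₀)).2.1 i]
  · have hdiff : ∀ j, |(p x).1 j - (p x₀).1 j| ≤ n / N := by
      intro j
      change |(x.1 j : ℝ) / N - (x₀.1 j : ℝ) / N| ≤ n / N
      rw [← sub_div, abs_div, abs_of_pos hN0]
      gcongr
      rw [abs_le]
      have h1 : (x.1 j : ℝ) ≤ x₀.1 j + n := by rw [hn]; exact_mod_cast (hx j).1
      have h2 : (x₀.1 j : ℝ) ≤ x.1 j + n := by rw [hn]; exact_mod_cast (hx j).2
      constructor <;> linarith
    have hd : dist (p x) (p x₀) < δ := by
      refine lt_of_le_of_lt ?_ hnδ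
      rw [Subtype.dist_eq, dist_pi_le_iff (by positivity)]
      exact hdiff
    have h1 : |(f (p x)).1 (c x) - (f (p x₀)).1 (c x)| < ε / 2 :=
      lt_of_le_of_lt (dist_le_pi_dist (f (p x)).1 (f (p x₀)).1 (c x)) (hfδ hd)
    have h2 := abs_lt.1 h1
    have h3 := abs_le.1 (hdiff (c x))
    linarith [hc x, h2.1, h2.2, h3.1, h3.2]

/-- **Brouwer's fixed point theorem** on the standard simplex. -/
theorem exists_fixedPoint_stdSimplex [Nonempty ι]
    {f : stdSimplex ℝ ι → stdSimplex ℝ ι} (hf : Continuous f) : ∃ x, f x = x := by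
  classical
  have : CompactSpace (stdSimplex ℝ ι) := isCompact_iff_compactSpace.1 (isCompact_stdSimplex ℝ ι)
  have : Nonempty (stdSimplex ℝ ι) := ⟨⟨_, single_mem_stdSimplex ℝ (Classical.arbitrary ι)⟩⟩
  -- The approximate inequalities force the minimum of `h` to be 0; then `x ≤ f x` coordinatewise,
  -- and equal sums give equality.
  let h : stdSimplex ℝ ι → ℝ := fun x => ∑ i, max 0 (x.1 i - (f x).1 i)
  have hh : Continuous h := by
    refine continuous_finsetSum _ fun i _ => continuous_const.max (Continuous.sub ?_ ?_)
    · exact (continuous_apply i).comp continuous_subtype_val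
    · exact (continuous_apply i).comp (continuous_subtype_val.comp hf)
  obtain ⟨x, -, hx⟩ := isCompact_univ.exists_isMinOn Set.univ_nonempty hh.continuousOn
  have hx0 : h x ≤ 0 := by
    refine le_of_forall_pos_le_add fun ε hε => ?_
    have hn : (0 : ℝ) < Fintype.card ι := by exact_mod_cast Fintype.card_pos
    obtain ⟨y, hy⟩ := exists_forall_le_add_of_continuous_stdSimplex hf (div_pos hε hn)
    calc h x ≤ h y := hx (Set.mem_univ y)
      _ ≤ ∑ _i : ι, ε / Fintype.card ι :=
        sum_le_sum fun i _ => max_le (by positivity) (by linarith [hy i])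
      _ = 0 + ε := by
        rw [sum_const, card_univ, nsmul_eq_mul, mul_div_cancel₀ _ hn.ne', zero_add]
  have hle : ∀ i, x.1 i ≤ (f x).1 i := by
    intro i
    have h1 : max 0 (x.1 i - (f x).1 i) ≤ h x :=
      single_le_sum (f := fun i => max 0 (x.1 i - (f x).1 i)) (fun _ _ => le_max_left _ _)
        (mem_univ i)
    linarith [le_max_right 0 (x.1 i - (f x).1 i)]
  refine ⟨x, Subtype.ext (funext fun i => ?_)⟩
  exact ((sum_eq_sum_iff_of_le fun i _ => hle i).1 (x.2.2.trans (f x).2.2.symm) i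
    (mem_univ i)).symm

end Brouwer

/-! ### Schauder's fixed point theorem -/

section Schauder

variable {Y : Type*} [NormedAddCommGroup Y] [NormedSpace ℝ Y] {A : Set Y}

/-- Schauder projection: `G` is followed by a partition of unity on an ε-net, and Brouwer is applied
to the barycentric coordinates. Only net points within `ε` of the image carry weight. -/
theorem exists_norm_sub_le_of_mapsTo_compact (hA : A.Nonempty) (hconv : Convex ℝ A) {G : A → A}
    (hG : Continuous G) {K : Set Y} (hK : IsCompact K) (hKA : K ⊆ A) (hGK : ∀ a, (G a : Y) ∈ K)
    {ε : ℝ} (hε : 0 < ε) : ∃ a : A, ‖(a : Y) - G a‖ ≤ ε := by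
  obtain ⟨t, htK, htfin, hcover⟩ := hK.finite_cover_balls hε
  have := htfin.fintype
  have hnear : ∀ y ∈ K, ∃ i : t, ‖y - i‖ < ε := by
    intro y hy
    obtain ⟨i, hi, hyi⟩ := Set.mem_iUnion₂.1 (hcover hy)
    exact ⟨⟨i, hi⟩, by rwa [← dist_eq_norm]⟩
  obtain ⟨a₀, ha₀⟩ := hA
  obtain ⟨i₀, -⟩ := hnear _ (hGK ⟨a₀, ha₀⟩)
  have : Nonempty t := ⟨i₀⟩
  let w : Y → t → ℝ := fun y i => max 0 (ε - ‖y - i‖)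
  have hw0 : ∀ y i, 0 ≤ w y i := fun y i => le_max_left _ _
  have hwc : ∀ i, Continuous fun y => w y i := fun i => by fun_prop
  have hs : ∀ y ∈ K, 0 < ∑ i, w y i := by
    intro y hy
    obtain ⟨i, hi⟩ := hnear y hy
    exact Finset.sum_pos' (fun i _ => hw0 y i)
      ⟨i, Finset.mem_univ i, lt_max_of_lt_right (sub_pos.2 hi)⟩
  let pt : stdSimplex ℝ t → A := fun l => ⟨∑ i, l.1 i • (i : Y),
    hconv.sum_mem (fun i _ => l.2.1 i) l.2.2 fun i _ => hKA (htK i.2)⟩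
  have hpt : Continuous pt := by
    refine Continuous.subtype_mk (continuous_finsetSum _ fun i _ => Continuous.smul ?_
      continuous_const) _
    exact (continuous_apply i).comp continuous_subtype_val
  let F : stdSimplex ℝ t → stdSimplex ℝ t := fun l =>
    ⟨fun i => w (G (pt l)) i / ∑ j, w (G (pt l)) j,
      fun i => div_nonneg (hw0 _ _) (Finset.sum_nonneg fun j _ => hw0 _ _), by
      rw [← Finset.sum_div, div_self (hs _ (hGK _)).ne']⟩
  have hGpt : Continuous fun l => (G (pt l) : Y) :=
    continuous_subtype_val.comp (hG.comp hpt)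
  have hF : Continuous F := by
    refine Continuous.subtype_mk (continuous_pi fun i => Continuous.div ((hwc i).comp hGpt)
      (continuous_finsetSum _ fun j _ => (hwc j).comp hGpt) fun l => (hs _ (hGK _)).ne') _
  obtain ⟨l, hl⟩ := exists_fixedPoint_stdSimplex hF
  refine ⟨pt l, ?_⟩
  have hl1 : ∑ i, l.1 i = 1 := l.2.2
  have hsub : (pt l : Y) - G (pt l) = ∑ i, l.1 i • ((i : Y) - G (pt l)) := by
    simp only [smul_sub, Finset.sum_sub_distrib, ← Finset.sum_smul, hl1, one_smul]
    rfl
  calc ‖(pt l : Y) - G (pt l)‖ ≤ ∑ i, ‖l.1 i • ((i : Y) - G (pt l))‖ := by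
        rw [hsub]
        exact norm_sum_le _ _
    _ ≤ ∑ i, l.1 i * ε := by
        refine Finset.sum_le_sum fun i _ => ?_
        rw [norm_smul, Real.norm_of_nonneg (l.2.1 i)]
        rcases le_total ‖(G (pt l) : Y) - i‖ ε with h | h
        · rw [norm_sub_rev]
          exact mul_le_mul_of_nonneg_left h (l.2.1 i)
        · have : l.1 i = 0 := by
            conv_lhs => rw [← hl]
            have : w (G (pt l)) i = 0 := max_eq_left (sub_nonpos.2 h)
            simp [F, this]
          simp [this]
    _ = ε := by rw [← Finset.sum_mul, hl1, one_mul]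

/-- **Schauder's fixed point theorem**: a continuous self-map of a nonempty convex set whose
values lie in a compact subset has a fixed point. -/
theorem exists_fixedPoint_of_mapsTo_compact (hA : A.Nonempty) (hconv : Convex ℝ A) {G : A → A}
    (hG : Continuous G) {K : Set Y} (hK : IsCompact K) (hKA : K ⊆ A)
    (hGK : ∀ a, (G a : Y) ∈ K) : ∃ a, G a = a := by
  have happ : ∀ n : ℕ, ∃ a : A, ‖(a : Y) - G a‖ ≤ 1 / ((n : ℝ) + 1) := fun n =>
    exists_norm_sub_le_of_mapsTo_compact hA hconv hG hK hKA hGK Nat.one_div_pos_of_nat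
  choose a ha using happ
  obtain ⟨x, hxK, φ, hφ, hlim⟩ := hK.tendsto_subseq fun n => hGK (a n)
  have hdiff : Filter.Tendsto (fun n => (a (φ n) : Y) - G (a (φ n))) Filter.atTop (nhds 0) :=
    squeeze_zero_norm (fun n => ha (φ n))
      (tendsto_one_div_add_atTop_nhds_zero_nat.comp hφ.tendsto_atTop)
  have hax : Filter.Tendsto (fun n => (a (φ n) : Y)) Filter.atTop (nhds x) := by
    simpa using hdiff.add hlim
  have hax' : Filter.Tendsto (fun n => a (φ n)) Filter.atTop (nhds (⟨x, hKA hxK⟩ : A)) :=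
    tendsto_subtype_rng.2 hax
  have h1 := (continuous_subtype_val.tendsto _).comp ((hG.tendsto _).comp hax')
  exact ⟨⟨x, hKA hxK⟩, Subtype.ext (tendsto_nhds_unique h1 hlim)⟩

end Schauder

/-! ### Kannan mappings -/

section Kannan

open Filter Topology

variable {Y : Type*} [NormedAddCommGroup Y] {A : Set Y}

/-- **Kannan's fixed point theorem** for continuous maps. -/
theorem exists_fixedPoint_of_kannan [CompleteSpace A] [Nonempty A] {f : A → A}
    (hf : Continuous f) {k : ℝ} (hk0 : 0 ≤ k) (hk : k < 1 / 2)
    (h : ∀ u v : A, ‖(f u : Y) - f v‖ ≤ k * (‖(f u : Y) - u‖ + ‖(f v : Y) - v‖)) :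
    ∃ u, f u = u := by
  obtain ⟨u₀⟩ := ‹Nonempty A›
  let u : ℕ → A := fun n => f^[n] u₀
  have hu : ∀ n, u (n + 1) = f (u n) := fun n => Function.iterate_succ_apply' f n u₀
  have hq : k / (1 - k) < 1 := by
    rw [div_lt_one (by linarith)]
    linarith
  -- The Kannan inequality has the new step on both sides; solving for it gives the ratio `k / (1 -
  -- k)`, below 1 exactly because `k < 1 / 2`.
  have hstep : ∀ n, dist (u (n + 1)) (u (n + 2)) ≤ k / (1 - k) * dist (u n) (u (n + 1)) := by
    intro n
    have h1 := h (u n) (u (n + 1))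
    rw [← hu n, ← hu (n + 1), norm_sub_rev (u (n + 1) : Y) (u n),
      norm_sub_rev (u (n + 1 + 1) : Y) (u (n + 1))] at h1
    rw [div_mul_eq_mul_div, le_div_iff₀ (by linarith), Subtype.dist_eq, Subtype.dist_eq,
      dist_eq_norm, dist_eq_norm]
    linarith
  have hgeom : ∀ n, dist (u n) (u (n + 1)) ≤ dist (u 0) (u 1) * (k / (1 - k)) ^ n := by
    intro n
    induction n with
    | zero => simp
    | succ n ih =>
      have hq0 : 0 ≤ k / (1 - k) := div_nonneg hk0 (by linarith)
      calc _ ≤ _ := hstep n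
        _ ≤ k / (1 - k) * (dist (u 0) (u 1) * (k / (1 - k)) ^ n) :=
          mul_le_mul_of_nonneg_left ih hq0
        _ = _ := by ring
  obtain ⟨x, hx⟩ := cauchySeq_tendsto_of_complete (cauchySeq_of_le_geometric _ _ hq hgeom)
  exact ⟨x, isFixedPt_of_tendsto_iterate hx hf.continuousAt⟩

/-- The fixed points of a Kannan equicontraction depend continuously on the parameter. -/
theorem continuous_fixedPoint_of_kannan {S : Type*} [TopologicalSpace S] {T : A × S → A}
    (hT : Continuous T) {k : ℝ}
    (h : ∀ (u₁ u₂ : A) (v : S), ‖(T (u₁, v) : Y) - T (u₂, v)‖ ≤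
      k * (‖(T (u₁, v) : Y) - u₁‖ + ‖(T (u₂, v) : Y) - u₂‖))
    {φ : S → A} (hφ : ∀ v, T (φ v, v) = φ v) : Continuous φ := by
  rw [continuous_iff_continuousAt]
  intro v
  -- At parameter `w` the point `φ w` has zero displacement, so only that of `φ v` remains.
  have hle : ∀ w, dist (φ w) (φ v) ≤ (1 + k) * ‖(T (φ v, w) : Y) - φ v‖ := by
    intro w
    have h1 := h (φ w) (φ v) w
    rw [hφ w, sub_self, norm_zero, zero_add] at h1
    rw [Subtype.dist_eq, dist_eq_norm]
    calc _ ≤ ‖(φ w : Y) - T (φ v, w)‖ + ‖(T (φ v, w) : Y) - φ v‖ :=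
          norm_sub_le_norm_sub_add_norm_sub _ _ _
      _ ≤ _ := by linarith
  have hlim : Tendsto (fun w => (1 + k) * ‖(T (φ v, w) : Y) - φ v‖) (𝓝 v) (𝓝 0) := by
    have hc : Continuous fun w => (1 + k) * ‖(T (φ v, w) : Y) - φ v‖ := by fun_prop
    simpa [hφ v] using hc.tendsto v
  exact tendsto_iff_dist_tendsto_zero.2 (squeeze_zero (fun _ => dist_nonneg) hle hlim)

end Kannan

theorem mainTheorem2
    {Y : Type*} [NormedAddCommGroup Y] [NormedSpace ℝ Y] [CompleteSpace Y]
    {X : Type*} [MetricSpace X] [CompleteSpace X]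
    (A : Set Y) (hA_nonempty : A.Nonempty) (hA_bounded : Bornology.IsBounded A)
    (hA_convex : Convex ℝ A) (hA_closed : IsClosed A)
    (C : A → X) (hC : IsCompactMapping C)
    (T : A × closure (Set.range C) → A) (hT_cont : Continuous T)
    (hT : IsKannanEquicontraction (fun p => (T p : Y))) :
    ∃ u : A, T (u, ⟨C u, subset_closure (Set.mem_range_self u)⟩) = u := by
  obtain ⟨k, hk0, hk, hkan⟩ := hT
  have := hA_closed.isComplete.completeSpace_coe
  have := hA_nonempty.to_subtype
  have hfix : ∀ v, ∃ u, T (u, v) = u := fun v =>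
    exists_fixedPoint_of_kannan (f := fun u => T (u, v)) (by fun_prop) hk0 hk
      fun u₁ u₂ => hkan u₁ u₂ v
  choose φ hφ using hfix
  have hφc : Continuous φ := continuous_fixedPoint_of_kannan hT_cont hkan hφ
  have hS : IsCompact (closure (Set.range C)) := by
    rw [← Set.image_univ]
    refine hC.2 _ ?_
    exact (isometry_subtype_coe.antilipschitz.isBounded_preimage hA_bounded).subset fun a _ => a.2
  have := isCompact_iff_compactSpace.1 hS
  have hcont : Continuous fun u : A => φ ⟨C u, subset_closure (Set.mem_range_self u)⟩ :=
    hφc.comp (hC.1.subtype_mk _)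
  obtain ⟨u, hu⟩ := exists_fixedPoint_of_mapsTo_compact hA_nonempty hA_convex hcont
    (isCompact_range (continuous_subtype_val.comp hφc)) (by rintro _ ⟨v, rfl⟩; exact (φ v).2)
    fun a => ⟨_, rfl⟩
  refine ⟨u, ?_⟩
  have := hφ ⟨C u, subset_closure (Set.mem_range_self u)⟩
  rwa [hu] at this
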